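/- Let $F:\mathbf{Set}\to\mathbf{Set}$ be a finitary functor (one preserving filtered colimits) with $F\emptyset\neq\emptyset$, and let $p\in F\emptyset$, regarded as a map $p:1\to F\emptyset$. Let $F^n0$ with connecting maps $w_{m,n}:F^m0\to F^n0$ be the initial-algebra chain ($F^00=\emptyset$, $F^{n+1}0=F(F^n0)$), with colimit $F^\omega0$ and injections $w_{n,\omega}$. Let $F^n1$ with connecting maps $v_{n,m}:F^n1\to F^m1$ ($n\ge m$) be the terminal-coalgebra chain ($F^01=1$, $F^{n+1}1=F(F^n1)$), with limit $F^\omega1$ and projections $v_{\omega,n}$. Let $\bar u:F^\omega0\to F^\omega1$ be the unique map with $v_{\omega,n}\cdot\bar u\cdot w_{n,\omega}=F^n!$ for all $n\in\mathbb N$, where $!:\emptyset\to1$, and put $$\varepsilon_n=\bar u\cdot w_{n+1,\omega}\cdot F^np\cdot v_{\omega,n}:F^\omega1\to F^\omega1 .$$ A cpo is a poset in which every nonempty directed subset has a join; a map between posets is continuous if it preserves all existing joins of nonempty directed subsets. A conservative completion of a poset $P$ is a cpo $\bar P$ containing $P$ as a subposet, with continuous inclusion, such that every continuous map from $P$ to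 a cpo has a unique continuous extension to $\bar P$. Then $F$ has an initial algebra $\iota:F(\mu F)\to\mu F$ and a terminal coalgebra $\tau:\nu F\to F(\nu F)$. Let $m:\mu F\to\nu F$ be the unique coalgebra homomorphism from $(\mu F,\iota^{-1})$ to $(\nu F,\tau)$, and $h:\nu F\to F^\omega1$ the canonical map, whose components $h_n=v_{\omega,n}\cdot h$ satisfy $h_{n+1}=Fh_n\cdot\tau$. Then: 1. The relation $t\sqsubseteq s$ iff $t=s$ or $t=\varepsilon_n(s)$ for some $n\in\mathbb N$ is a partial order on $F^\omega1$. The maps $h$ and $m$ are injective, so that $\nu F$ becomes a subposet of $F^\omega1$ via $h$, and $\mu F$ a subposet of $\nu F$ via $m$. 2. $F^\omega1$ is a conservative completion of $\nu F$ (via $h$) and also of $\mu F$ (via $h\cdot m$). Thus the conservative completions of $\mu F$ and $\nu F$ coincide. 3. Order $F(\nu F)$ and $F(\mu F)$ so that the bijections $\tau$ and $\iota$ are order isomorphisms. Then $F(\mu F)$ is a subposet of $F(\nu F)$ via $Fm$, the map $\iota^{-1}$ is continuous, and $\tau$ is the unique continuous extension of $\iota^{-1}$: it is the unique continuous map $g:\nu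 F\to F(\nu F)$ with $g\cdot m=Fm\cdot\iota^{-1}$. -/

import Mathlib

universe u

open CategoryTheory CategoryTheory.Limits

namespace SetFunctor

noncomputable section

/-- The finite stages `Fⁿ0` of the initial-algebra chain of a set functor. -/
def initChain (F : Type u ⥤ Type u) : ℕ → Type u
  | 0 => PEmpty.{u + 1}
  | n + 1 => F.obj (initChain F n)

/-- The connecting maps `w_{n,n+1} : Fⁿ0 ⟶ Fⁿ⁺¹0`. -/
def initChainMap (F : Type u ⥤ Type u) : ∀ n : ℕ, initChain F n ⟶ initChain F (n + 1)
  | 0 => ↾(fun x : PEmpty.{u + 1} => x.elim)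
  | n + 1 => F.map (initChainMap F n)

/-- The finite stages `Fⁿ1` of the terminal-coalgebra chain of a set functor. -/
def termChain (F : Type u ⥤ Type u) : ℕ → Type u
  | 0 => PUnit.{u + 1}
  | n + 1 => F.obj (termChain F n)

/-- The connecting maps `v_{n+1,n} : Fⁿ⁺¹1 ⟶ Fⁿ1`. -/
def termChainMap (F : Type u ⥤ Type u) : ∀ n : ℕ, termChain F (n + 1) ⟶ termChain F n
  | 0 => ↾(fun _ => PUnit.unit)
  | n + 1 => F.map (termChainMap F n)

/-- `F^ω 0`, the colimit of the finite stages of the initial-algebra chain. -/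
def OmegaColimit (F : Type u ⥤ Type u) : Type u :=
  colimit (Functor.ofSequence (initChainMap F))

/-- The colimit injections `w_{n,ω} : Fⁿ0 ⟶ F^ω 0`. -/
def initInj (F : Type u ⥤ Type u) (n : ℕ) : initChain F n ⟶ OmegaColimit F :=
  colimit.ι (Functor.ofSequence (initChainMap F)) n

/-- `F^ω 1`, the limit of the finite stages of the terminal-coalgebra chain. -/
def OmegaLimit (F : Type u ⥤ Type u) : Type u :=
  {x : ∀ n : ℕ, termChain F n // ∀ n, termChainMap F n (x (n + 1)) = x n}

/-- The limit projections `v_{ω,n} : F^ω 1 ⟶ Fⁿ1`. -/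
def termProj (F : Type u ⥤ Type u) (n : ℕ) : OmegaLimit F ⟶ termChain F n :=
  ↾(fun x => x.1 n)

/-- The canonical maps `Fᵐ0 ⟶ Fⁿ1`: the unique map `!` if `m = 0` or `n = 0`, and `F` applied to
the canonical map `Fᵐ0 ⟶ Fⁿ1` for `m + 1`, `n + 1`. On the diagonal it is `Fⁿ!`. -/
def cross (F : Type u ⥤ Type u) : ∀ m n : ℕ, initChain F m ⟶ termChain F n
  | 0, _ => ↾(fun x : PEmpty.{u + 1} => x.elim)
  | _ + 1, 0 => ↾(fun _ => PUnit.unit)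
  | m + 1, n + 1 => F.map (cross F m n)

theorem initChainMap_cross (F : Type u ⥤ Type u) (m n : ℕ) :
    initChainMap F m ≫ cross F (m + 1) n = cross F m n := by
  induction m generalizing n with
  | zero => ext x; exact x.elim
  | succ m ih =>
    cases n with
    | zero => rfl
    | succ n =>
      change F.map (initChainMap F m) ≫ F.map (cross F (m + 1) n) = F.map (cross F m n)
      rw [← F.map_comp, ih]

theorem cross_termChainMap (F : Type u ⥤ Type u) (m n : ℕ) :
    cross F m (n + 1) ≫ termChainMap F n = cross F m n := by
  induction m generalizing n with
  | zero => ext x; exact x.elim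
  | succ m ih =>
    cases n with
    | zero => rfl
    | succ n =>
      change F.map (cross F m (n + 1)) ≫ F.map (termChainMap F n) = F.map (cross F m n)
      rw [← F.map_comp, ih]

/-- The canonical map `Fᵐ0 ⟶ F^ω 1`, whose components are the canonical maps `Fᵐ0 ⟶ Fⁿ1`. -/
def stageToLimit (F : Type u ⥤ Type u) (m : ℕ) : initChain F m ⟶ OmegaLimit F :=
  ↾(fun z => ⟨fun n => cross F m n z,
    fun n => ConcreteCategory.congr_hom (cross_termChainMap F m n) z⟩)

theorem initChainMap_stageToLimit (F : Type u ⥤ Type u) (m : ℕ) :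
    initChainMap F m ≫ stageToLimit F (m + 1) = stageToLimit F m := by
  ext z
  exact Subtype.ext (funext fun n => ConcreteCategory.congr_hom (initChainMap_cross F m n) z)

/-- The canonical comparison map `ū : F^ω 0 ⟶ F^ω 1`. -/
def uBar (F : Type u ⥤ Type u) : OmegaColimit F ⟶ OmegaLimit F :=
  colimit.desc (Functor.ofSequence (initChainMap F))
    { pt := OmegaLimit F
      ι := NatTrans.ofSequence (F := Functor.ofSequence (initChainMap F))
        (G := (Functor.const ℕ).obj (OmegaLimit F)) (stageToLimit F) (fun n => by
          rw [Functor.ofSequence_map_homOfLE_succ]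
          exact (initChainMap_stageToLimit F n).trans (Category.comp_id _).symm) }

/-- `ū` is characterised by `v_{ω,n} ∘ ū ∘ w_{n,ω} = Fⁿ!` for all `n`, where `cross F n n = Fⁿ!`. -/
theorem initInj_uBar_termProj (F : Type u ⥤ Type u) (n : ℕ) :
    initInj F n ≫ uBar F ≫ termProj F n = cross F n n := by
  have h : initInj F n ≫ uBar F = stageToLimit F n := colimit.ι_desc _ _
  rw [← Category.assoc, h]
  rfl

/-- `Fⁿp : Fⁿ1 ⟶ Fⁿ⁺¹0` for an element `p` of `F∅`, regarded as a map `p : 1 ⟶ F∅`. -/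
def iterPoint (F : Type u ⥤ Type u) (p : F.obj PEmpty.{u + 1}) :
    ∀ n : ℕ, termChain F n ⟶ initChain F (n + 1)
  | 0 => ↾(fun _ => p)
  | n + 1 => F.map (iterPoint F p n)

/-- `e_n = ū ∘ w_{n+1,ω} ∘ Fⁿp : Fⁿ1 ⟶ F^ω 1`. -/
def eMap (F : Type u ⥤ Type u) (p : F.obj PEmpty.{u + 1}) (n : ℕ) :
    termChain F n ⟶ OmegaLimit F :=
  iterPoint F p n ≫ initInj F (n + 1) ≫ uBar F

/-- `ε_n = e_n ∘ v_{ω,n} : F^ω 1 ⟶ F^ω 1`. -/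
def epsilon (F : Type u ⥤ Type u) (p : F.obj PEmpty.{u + 1}) (n : ℕ) :
    OmegaLimit F ⟶ OmegaLimit F :=
  termProj F n ≫ eMap F p n

/-- The components `X ⟶ Fⁿ1` of the canonical cone of a coalgebra `(X, ξ)` over the
terminal-coalgebra chain: `h₀ = !` and `h_{n+1} = F h_n ∘ ξ`. -/
def coalgToStage {F : Type u ⥤ Type u} (X : Endofunctor.Coalgebra F) :
    ∀ n : ℕ, X.V ⟶ termChain F n
  | 0 => ↾(fun _ => PUnit.unit)
  | n + 1 => X.str ≫ F.map (coalgToStage X n)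

theorem coalgToStage_termChainMap {F : Type u ⥤ Type u} (X : Endofunctor.Coalgebra F) (n : ℕ) :
    coalgToStage X (n + 1) ≫ termChainMap F n = coalgToStage X n := by
  induction n with
  | zero => rfl
  | succ n ih =>
    change (X.str ≫ F.map (coalgToStage X (n + 1))) ≫ F.map (termChainMap F n) =
      X.str ≫ F.map (coalgToStage X n)
    rw [Category.assoc, ← F.map_comp, ih]

/-- The canonical map of a coalgebra into `F^ω 1`. For the terminal coalgebra of a finitary functor,
carried by `νF = F^{ω+ω} 1`, this is the connecting map `v_{ω+ω,ω}`. -/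
def coalgToLimit {F : Type u ⥤ Type u} (X : Endofunctor.Coalgebra F) : X.V ⟶ OmegaLimit F :=
  ↾(fun x => ⟨fun n => coalgToStage X n x,
    fun n => ConcreteCategory.congr_hom (coalgToStage_termChainMap X n) x⟩)

/-- The inverse `ι⁻¹` of the structure map of an initial algebra. -/
abbrev iotaInv {F : Type u ⥤ Type u} {M : Endofunctor.Algebra F} (hM : IsInitial M) :
    M.a ⟶ F.obj M.a :=
  Endofunctor.Algebra.Initial.strInv hM

/-- The unique coalgebra homomorphism `m : (μF, ι⁻¹) ⟶ (νF, τ)`. -/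
def muToNu {F : Type u ⥤ Type u} {M : Endofunctor.Algebra F} (hM : IsInitial M)
    {N : Endofunctor.Coalgebra F} (hN : IsTerminal N) : M.a ⟶ N.V :=
  (hN.from ⟨M.a, iotaInv hM⟩).f

end

/-- A cpo: a poset in which every (nonempty) directed subset has a join. -/
def IsCpo (P : Type u) [PartialOrder P] : Prop :=
  ∀ D : Set P, D.Nonempty → DirectedOn (· ≤ ·) D → ∃ x, IsLUB D x

/-- `i : P → K` exhibits `K` as a conservative completion of the poset `P`: `K` is a cpo, `i` embeds
`P` as a subposet and preserves all directed joins which exist in `P`, and every continuous map from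
`P` into a cpo has a unique continuous extension along `i`. -/
structure IsConservativeCompletion {P K : Type u} [PartialOrder P] [PartialOrder K]
    (i : P → K) : Prop where
  isCpo : IsCpo K
  le_iff_le : ∀ x y : P, i x ≤ i y ↔ x ≤ y
  continuous : ScottContinuous i
  existsUnique_extension : ∀ (Q : Type u) [PartialOrder Q], IsCpo Q →
    ∀ f : P → Q, ScottContinuous f → ∃! g : K → Q, ScottContinuous g ∧ ∀ x, g (i x) = f x

end SetFunctor

/-!
The element `ε_n(s)` has the same component as `s` at stage `n` and depends on that component only,
so the `ε_n` behave like truncations of sequences: `ε_n ∘ ε_k = ε_(min n k)`, and `s` is the join of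
the chain of its truncations `ε_n(s)`. The image of a directed set under `ε_n` has a greatest
element, as a strictly ascending chain in the image of `ε_n` has at most `n` steps; hence joins of
directed sets are computed componentwise. Consequently a continuous map on `F^ω 1` is determined by
its values on any subset containing all elements `ε_n(s)`, and every continuous map on such a
subposet extends, by taking joins of the values on truncations.

The subsets `νF` and `μF` of `F^ω 1` are of this kind. The maps `ε_n` factor through `ū`, which is
`h ∘ m` up to the isomorphism `F^ω 0 ≅ μF`, and `ū` is injective because
`w_{n+1,ω} ∘ Fⁿp ∘ v_{ω,n}` inverts it on the stages up to `n`. The map `h` is injective because,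
`F` being finitary, the connecting map `F(F^ω 1) ⟶ F^ω 1` is injective, so that the elements of
`F^ω 1` which occur as images of elements of coalgebras carry a terminal coalgebra.
-/

namespace SetFunctor

section DirectedDense

variable {P Q : Type*} [PartialOrder P] [PartialOrder Q]

/-- A subset of a poset is directed-dense if every element is the join of a nonempty directed set
of elements of the subset. Continuous maps are determined by their values on such a subset. -/
def DirectedDense (S : Set P) : Prop :=
  ∀ t, ∃ D ⊆ S, D.Nonempty ∧ DirectedOn (· ≤ ·) D ∧ IsLUB D t

theorem DirectedDense.eq_of_eqOn {S : Set P} (hS : DirectedDense S) {f g : P → Q}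
    (hf : ScottContinuous f) (hg : ScottContinuous g) (hfg : Set.EqOn f g S) : f = g := by
  funext t
  obtain ⟨D, hDS, hne, hdir, hlub⟩ := hS t
  have hft : IsLUB (g '' D) (f t) := (hfg.mono hDS).image_eq ▸ hf hne hdir hlub
  exact hft.unique (hg hne hdir hlub)

theorem scottContinuous_orderIso (f : P ≃o Q) : ScottContinuous f :=
  fun _ _ _ _ ha => f.isLUB_image'.2 ha

/-- A bijection onto a poset, as an order isomorphism for the pulled back order. -/
def liftOrderIso {A : Type*} (e : A ≃ P) :
    letI := PartialOrder.lift e e.injective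
    A ≃o P :=
  letI := PartialOrder.lift e e.injective
  ⟨e, Iff.rfl⟩

theorem directedOn_range_of_monotone {r : ℕ → P} (hr : Monotone r) :
    DirectedOn (· ≤ ·) (Set.range r) :=
  directedOn_range.2 hr.directed_le

theorem exists_isGreatest_or_forall_exists_lt {D : Set P} (hdir : DirectedOn (· ≤ ·) D) :
    (∃ x, IsGreatest D x) ∨ ∀ x ∈ D, ∃ y ∈ D, x < y := by
  refine or_iff_not_imp_left.2 fun hD x hx => ?_
  by_contra! hmax
  exact hD ⟨x, hx, hdir.is_top_of_is_max hx fun y hy hxy => (hxy.eq_of_not_lt (hmax y hy)).ge⟩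

end DirectedDense

/-- The partial order induced by operators `e n` which compose by taking minima of indices:
`t ≤ s` iff `t = s` or `t = e n s` for some `n`. -/
abbrev truncationOrder {K : Type*} (e : ℕ → K → K)
    (comp : ∀ n k s, e n (e k s) = e (min n k) s) : PartialOrder K where
  le t s := t = s ∨ ∃ n, t = e n s
  le_refl _ := Or.inl rfl
  le_trans t s r := by
    rintro (rfl | ⟨n, rfl⟩) (rfl | ⟨k, rfl⟩)
    · exact Or.inl rfl
    · exact Or.inr ⟨k, rfl⟩
    · exact Or.inr ⟨n, rfl⟩
    · exact Or.inr ⟨min n k, comp n k r⟩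
  le_antisymm t s := by
    rintro (rfl | ⟨n, hn⟩) (hst | ⟨k, hk⟩)
    · rfl
    · rfl
    · exact hst.symm
    · rcases le_total n k with hnk | hkn
      · rw [hk, hn, comp, min_eq_right hnk]
      · rw [hn, hk, comp, min_eq_right hkn, ← hk]

/-- Operators `e n` on a poset, such as the `ε_n` on `F^ω 1`, which truncate its elements at
level `n`: the elements below `s` are `s` and its truncations, truncations compose by taking minima,
elements are determined by their truncations, and every coherent sequence of truncations comes
from an element. -/
structure IsTruncationSystem {K : Type*} [PartialOrder K] (e : ℕ → K → K) : Prop where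
  le_iff : ∀ t s, t ≤ s ↔ t = s ∨ ∃ n, t = e n s
  comp : ∀ n k s, e n (e k s) = e (min n k) s
  ext : ∀ t s, (∀ n, e n t = e n s) → t = s
  exists_of_coherent : ∀ x : ℕ → K, (∀ n, e n (x (n + 1)) = e n (x n)) →
    ∃ l, ∀ n, e n l = e n (x n)

namespace IsTruncationSystem

section Joins

variable {K : Type*} [PartialOrder K] {e : ℕ → K → K} (h : IsTruncationSystem e)
include h

theorem apply_le (n : ℕ) (s : K) : e n s ≤ s := (h.le_iff _ _).2 (Or.inr ⟨n, rfl⟩)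

theorem apply_apply_of_le {n k : ℕ} (hnk : n ≤ k) (s : K) : e n (e k s) = e n s := by
  rw [h.comp, min_eq_left hnk]

theorem apply_eq_self_of_le {n k : ℕ} (hnk : n ≤ k) {s : K} (hs : e n s = s) : e k s = s := by
  rw [← hs, h.comp, min_eq_right hnk]

theorem monotone_index (s : K) : Monotone fun n => e n s := fun n _ hnk =>
  (h.apply_apply_of_le hnk s).symm.trans_le (h.apply_le n _)

theorem monotone_apply (n : ℕ) : Monotone (e n) := fun t s hts => by
  rcases (h.le_iff _ _).1 hts with rfl | ⟨k, rfl⟩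
  · exact le_rfl
  · exact (h.comp n k s).trans_le (h.monotone_index s (min_le_left n k))

theorem apply_eq_apply_or_apply_eq_self {t s : K} (hts : t ≤ s) (n : ℕ) :
    e n t = e n s ∨ e n t = t := by
  rcases (h.le_iff _ _).1 hts with rfl | ⟨k, rfl⟩
  · exact Or.inl rfl
  · rcases le_total n k with hnk | hkn
    · exact Or.inl (h.apply_apply_of_le hnk s)
    · exact Or.inr (by rw [h.comp, min_eq_right hkn])

theorem le_of_forall_apply_le {t s : K} (hts : ∀ n, e n t ≤ s) : t ≤ s := by
  by_cases hall : ∀ n, e n t = e n s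
  · exact (h.ext _ _ hall).le
  push Not at hall
  obtain ⟨n, hn⟩ := hall
  have hstable : ∀ k, n ≤ k → e k t = e n t := fun k hnk => by
    have := h.apply_eq_apply_or_apply_eq_self (hts k) n
    rw [h.apply_apply_of_le hnk] at this
    exact (this.resolve_left hn).symm
  have ht : t = e n t := h.ext _ _ fun k => by
    rcases le_total n k with hnk | hkn
    · rw [h.comp, min_eq_right hnk, hstable k hnk]
    · rw [h.apply_apply_of_le hkn]
  exact ht.trans_le (hts n)

theorem isLUB_range_apply (t : K) : IsLUB (Set.range fun n => e n t) t :=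
  ⟨Set.forall_mem_range.2 fun n => h.apply_le n t,
    fun _ hs => h.le_of_forall_apply_le fun n => hs ⟨n, rfl⟩⟩

theorem exists_lt_apply_eq_self_of_lt {n : ℕ} {t s : K} (hts : t < s) (hs : e n s = s) :
    ∃ k < n, e k t = t := by
  obtain ⟨k, rfl⟩ := ((h.le_iff _ _).1 hts.le).resolve_left hts.ne
  refine ⟨k, lt_of_not_ge fun hnk => hts.ne (h.apply_eq_self_of_le hnk hs), ?_⟩
  exact h.apply_apply_of_le le_rfl s

/-- By descent on `n`: if `D` has no greatest element, then each of its elements lies strictly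
below an element of level at most `n`, and is thus of smaller level. -/
theorem exists_isGreatest_of_forall_apply_eq_self {D : Set K} (hne : D.Nonempty)
    (hdir : DirectedOn (· ≤ ·) D) {n : ℕ} (hn : ∀ x ∈ D, e n x = x) : ∃ x, IsGreatest D x := by
  refine (exists_isGreatest_or_forall_exists_lt hdir).resolve_right fun hlt => ?_
  have hlevel : ∀ n, (∀ x ∈ D, e n x = x) → ∀ x ∈ D, ∃ k < n, e k x = x := fun n hn x hx => by
    obtain ⟨y, hy, hxy⟩ := hlt x hx
    exact h.exists_lt_apply_eq_self_of_lt hxy (hn y hy)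
  obtain ⟨x, hx⟩ := hne
  induction n with
  | zero =>
    obtain ⟨k, hk, -⟩ := hlevel 0 hn x hx
    exact absurd hk k.not_lt_zero
  | succ n ih =>
    refine ih fun y hy => ?_
    obtain ⟨k, hk, hky⟩ := hlevel (n + 1) hn y hy
    exact h.apply_eq_self_of_le (Nat.le_of_lt_succ hk) hky

theorem exists_isGreatest_image_apply {D : Set K} (hne : D.Nonempty)
    (hdir : DirectedOn (· ≤ ·) D) (n : ℕ) : ∃ x ∈ D, ∀ y ∈ D, e n y ≤ e n x := by
  have hdir' : DirectedOn (· ≤ ·) (e n '' D) := hdir.mono_comp (h.monotone_apply n)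
  obtain ⟨_, ⟨x, hx, rfl⟩, hmax⟩ := h.exists_isGreatest_of_forall_apply_eq_self (hne.image _) hdir'
    (Set.forall_mem_image.2 fun y _ => h.apply_apply_of_le le_rfl y)
  exact ⟨x, hx, fun y hy => hmax ⟨y, hy, rfl⟩⟩

theorem exists_isLUB_and_forall_exists_apply_eq {D : Set K} (hne : D.Nonempty)
    (hdir : DirectedOn (· ≤ ·) D) : ∃ l, IsLUB D l ∧ ∀ n, ∃ x ∈ D, e n x = e n l := by
  choose x hxD hmax using h.exists_isGreatest_image_apply hne hdir
  have hcoh : ∀ n, e n (x (n + 1)) = e n (x n) := fun n => by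
    refine (hmax n _ (hxD (n + 1))).antisymm ?_
    have := h.monotone_apply n (hmax (n + 1) _ (hxD n))
    rwa [h.apply_apply_of_le n.le_succ, h.apply_apply_of_le n.le_succ] at this
  obtain ⟨l, hl⟩ := h.exists_of_coherent x hcoh
  refine ⟨l, ⟨fun y hy => h.le_of_forall_apply_le fun n => ?_,
    fun u hu => h.le_of_forall_apply_le fun n => ?_⟩, fun n => ⟨x n, hxD n, (hl n).symm⟩⟩
  · exact (hmax n y hy).trans ((hl n).symm.trans_le (h.apply_le n l))
  · exact (hl n).trans_le ((h.apply_le n _).trans (hu (hxD n)))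

theorem exists_apply_eq_of_isLUB {D : Set K} (hne : D.Nonempty) (hdir : DirectedOn (· ≤ ·) D)
    {a : K} (ha : IsLUB D a) (n : ℕ) : ∃ x ∈ D, e n x = e n a := by
  obtain ⟨l, hl, hx⟩ := h.exists_isLUB_and_forall_exists_apply_eq hne hdir
  exact ha.unique hl ▸ hx n

theorem scottContinuous_of_isLUB_range {Q : Type*} [PartialOrder Q] {g : K → Q}
    (hg : ∀ s, IsLUB (Set.range fun n => g (e n s)) (g s)) : ScottContinuous g := by
  have hmono : Monotone g := fun t s hts => by
    rcases (h.le_iff _ _).1 hts with rfl | ⟨n, rfl⟩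
    · exact le_rfl
    · exact (hg s).1 ⟨n, rfl⟩
  intro D hne hdir a ha
  refine ⟨hmono.mem_upperBounds_image ha.1, fun u hu => (hg a).2 ?_⟩
  rintro _ ⟨n, rfl⟩
  obtain ⟨x, hx, hxa⟩ := h.exists_apply_eq_of_isLUB hne hdir ha n
  calc g (e n a) = g (e n x) := by rw [hxa]
    _ ≤ g x := hmono (h.apply_le n x)
    _ ≤ u := hu ⟨x, hx, rfl⟩

end Joins

section Embedding

variable {P K : Type*} [PartialOrder P] [PartialOrder K] {e : ℕ → K → K}
  (h : IsTruncationSystem e) (i : P ↪o K)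
include h

theorem monotone_of_apply_eq {s : K} {r : ℕ → P} (hr : ∀ n, i (r n) = e n s) : Monotone r :=
  fun n k hnk => by
    rw [← i.le_iff_le, hr, hr]
    exact h.monotone_index s hnk

theorem isLUB_range_of_apply_eq {t : P} {r : ℕ → P} (hr : ∀ n, i (r n) = e n (i t)) :
    IsLUB (Set.range r) t := by
  refine IsLUB.of_image i.le_iff_le ?_
  rw [← Set.range_comp, show i ∘ r = fun n => e n (i t) from funext hr]
  exact h.isLUB_range_apply (i t)

theorem directedDense {S : Set P} (hS : ∀ n s, e n s ∈ i '' S) : DirectedDense S := fun t => by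
  choose r hrS hr using fun n => hS n (i t)
  exact ⟨Set.range r, Set.range_subset_iff.2 hrS, Set.range_nonempty r,
    directedOn_range_of_monotone (h.monotone_of_apply_eq i hr), h.isLUB_range_of_apply_eq i hr⟩

theorem scottContinuous_embedding (hi : ∀ n s, e n s ∈ Set.range i) : ScottContinuous i :=
  fun D hne hdir a ha => by
    obtain ⟨l, hl, -⟩ :=
      h.exists_isLUB_and_forall_exists_apply_eq (hne.image i) (hdir.mono_comp i.monotone)
    have hla : l ≤ i a := hl.2 (i.monotone.mem_upperBounds_image ha.1)
    -- if `l` were different from `i a`, it would be a truncation, and thus a bound in `P`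
    suffices hal : i a ≤ l from hla.antisymm hal ▸ hl
    rcases (h.le_iff _ _).1 hla with rfl | ⟨n, rfl⟩
    · exact le_rfl
    · obtain ⟨b, hb⟩ := hi n (i a)
      rw [← hb] at hl ⊢
      exact i.monotone (ha.2 fun x hx => i.le_iff_le.1 (hl.1 ⟨x, hx, rfl⟩))

end Embedding

variable {P K : Type u} [PartialOrder P] [PartialOrder K] {e : ℕ → K → K}

theorem exists_scottContinuous_extension (h : IsTruncationSystem e) (i : P ↪o K)
    (hi : ∀ n s, e n s ∈ Set.range i) {Q : Type u} [PartialOrder Q] (hQ : IsCpo Q) {f : P → Q}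
    (hf : ScottContinuous f) : ∃ g : K → Q, ScottContinuous g ∧ ∀ x, g (i x) = f x := by
  choose r hr using hi
  have hmono : ∀ s, Monotone fun n => r n s := fun s => h.monotone_of_apply_eq i fun n => hr n s
  choose g hg using fun s => hQ (Set.range fun n => f (r n s)) (Set.range_nonempty _)
    (directedOn_range_of_monotone (hf.monotone.comp (hmono s)))
  have hgi : ∀ x, g (i x) = f x := fun x => by
    have hfx := hf (Set.range_nonempty _) (directedOn_range_of_monotone (hmono (i x)))
      (h.isLUB_range_of_apply_eq i fun n => hr n (i x))
    rw [← Set.range_comp] at hfx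
    exact (hg (i x)).unique hfx
  refine ⟨g, h.scottContinuous_of_isLUB_range fun s => ?_, hgi⟩
  simp only [← hr, hgi]
  exact hg s

theorem isConservativeCompletion (h : IsTruncationSystem e) (i : P ↪o K)
    (hi : ∀ n s, e n s ∈ Set.range i) : IsConservativeCompletion i where
  isCpo D hne hdir :=
    have ⟨l, hl, _⟩ := h.exists_isLUB_and_forall_exists_apply_eq hne hdir
    ⟨l, hl⟩
  le_iff_le _ _ := i.le_iff_le
  continuous := h.scottContinuous_embedding i hi
  existsUnique_extension Q _ hQ f hf := by
    obtain ⟨g, hg, hgi⟩ := h.exists_scottContinuous_extension i hi hQ hf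
    have hdense : DirectedDense (Set.range i) :=
      h.directedDense (RelEmbedding.refl _) fun n s => ⟨_, hi n s, rfl⟩
    refine ⟨g, ⟨hg, hgi⟩, fun g' ⟨hg', hgi'⟩ => hdense.eq_of_eqOn hg' hg ?_⟩
    rintro _ ⟨x, rfl⟩
    rw [hgi, hgi']

end IsTruncationSystem

section Chains

variable (F : Type u ⥤ Type u)

theorem initInj_uBar (n : ℕ) : initInj F n ≫ uBar F = stageToLimit F n :=
  colimit.ι_desc _ _

theorem initChainMap_initInj (n : ℕ) : initChainMap F n ≫ initInj F (n + 1) = initInj F n := by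
  rw [← Functor.ofSequence_map_homOfLE_succ (initChainMap F) n]
  exact colimit.w (Functor.ofSequence (initChainMap F)) (homOfLE n.le_succ)

theorem exists_comp_initInj_eq {m n : ℕ} (hmn : m ≤ n) :
    ∃ w : initChain F m ⟶ initChain F n, w ≫ initInj F n = initInj F m :=
  ⟨_, colimit.w (Functor.ofSequence (initChainMap F)) (homOfLE hmn)⟩

variable {F}

theorem exists_initInj_eq (x : OmegaColimit F) : ∃ n z, initInj F n z = x :=
  Types.jointly_surjective' x

theorem OmegaColimit.hom_ext {X : Type u} {f g : OmegaColimit F ⟶ X}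
    (h : ∀ n, initInj F n ≫ f = initInj F n ≫ g) : f = g :=
  colimit.hom_ext h

theorem OmegaLimit.hom_ext {X : Type u} {f g : X ⟶ OmegaLimit F}
    (h : ∀ n, f ≫ termProj F n = g ≫ termProj F n) : f = g := by
  ext x
  exact Subtype.ext (funext fun n => ConcreteCategory.congr_hom (h n) x)

theorem OmegaLimit.val_eq_val_of_le {x y : OmegaLimit F} {n k : ℕ} (hnk : n ≤ k)
    (hxy : x.1 k = y.1 k) : x.1 n = y.1 n := by
  induction k, hnk using Nat.le_induction with
  | base => exact hxy
  | succ k _ ih => exact ih (by rw [← x.2 k, ← y.2 k, hxy])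

end Chains

section Truncation

variable {F : Type u ⥤ Type u} (p : F.obj PEmpty.{u + 1})

theorem iterPoint_cross (n : ℕ) : iterPoint F p n ≫ cross F (n + 1) n = 𝟙 (termChain F n) := by
  induction n with
  | zero => rfl
  | succ n ih =>
    change F.map (iterPoint F p n) ≫ F.map (cross F (n + 1) n) = 𝟙 (F.obj (termChain F n))
    rw [← F.map_comp, ih, F.map_id]

theorem cross_iterPoint (n : ℕ) : cross F n n ≫ iterPoint F p n = initChainMap F n := by
  induction n with
  | zero => ext x; exact x.elim
  | succ n ih =>
    change F.map (cross F n n) ≫ F.map (iterPoint F p n) = F.map (initChainMap F n)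
    rw [← F.map_comp, ih]

/-- The maps `w_{n+1,ω} ∘ Fⁿp ∘ v_{ω,n} : F^ω 1 ⟶ F^ω 0`. Composing with `ū` on the left yields
`ε_n`, and composing with `ū` on the right yields the identity on the stages up to `n`. -/
noncomputable def limitToColimit (n : ℕ) : OmegaLimit F ⟶ OmegaColimit F :=
  termProj F n ≫ iterPoint F p n ≫ initInj F (n + 1)

theorem initInj_uBar_limitToColimit {m n : ℕ} (hmn : m ≤ n) :
    initInj F m ≫ uBar F ≫ limitToColimit p n = initInj F m := by
  have hstage : initInj F n ≫ uBar F ≫ limitToColimit p n = initInj F n := calc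
    _ = (initInj F n ≫ uBar F ≫ termProj F n) ≫ iterPoint F p n ≫ initInj F (n + 1) := rfl
    _ = (cross F n n ≫ iterPoint F p n) ≫ initInj F (n + 1) := by
      rw [initInj_uBar_termProj, Category.assoc]
    _ = initInj F n := by rw [cross_iterPoint, initChainMap_initInj]
  obtain ⟨w, hw⟩ := exists_comp_initInj_eq F hmn
  rw [← hw, Category.assoc, hstage]

include p in
theorem uBar_injective : Function.Injective (uBar F) := fun x y hxy => by
  obtain ⟨m, z, rfl⟩ := exists_initInj_eq x
  obtain ⟨k, w, rfl⟩ := exists_initInj_eq y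
  rw [← ConcreteCategory.congr_hom (initInj_uBar_limitToColimit p (le_max_left m k)) z,
    ← ConcreteCategory.congr_hom (initInj_uBar_limitToColimit p (le_max_right m k)) w]
  exact congrArg (limitToColimit p (max m k)) hxy

theorem epsilon_mem_range_uBar (n : ℕ) (s : OmegaLimit F) :
    epsilon F p n s ∈ Set.range (uBar F) :=
  ⟨limitToColimit p n s, rfl⟩

theorem eMap_termProj (n : ℕ) : eMap F p n ≫ termProj F n = 𝟙 (termChain F n) := calc
  _ = iterPoint F p n ≫ (initInj F (n + 1) ≫ uBar F) ≫ termProj F n := rfl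
  _ = iterPoint F p n ≫ cross F (n + 1) n := by rw [initInj_uBar]; rfl
  _ = 𝟙 (termChain F n) := iterPoint_cross p n

theorem epsilon_eq_epsilon_iff {n : ℕ} {x y : OmegaLimit F} :
    epsilon F p n x = epsilon F p n y ↔ x.1 n = y.1 n := by
  have hinj : Function.Injective (eMap F p n) :=
    Function.LeftInverse.injective (g := termProj F n)
      (ConcreteCategory.congr_hom (eMap_termProj p n))
  exact hinj.eq_iff

theorem epsilon_apply_val {n k : ℕ} (hnk : n ≤ k) (x : OmegaLimit F) :
    (epsilon F p k x).1 n = x.1 n :=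
  OmegaLimit.val_eq_val_of_le hnk (ConcreteCategory.congr_hom (eMap_termProj p k) (x.1 k))

theorem epsilon_epsilon (n k : ℕ) (x : OmegaLimit F) :
    epsilon F p n (epsilon F p k x) = epsilon F p (min n k) x := by
  rcases Nat.lt_or_ge k n with hkn | hnk
  · rw [min_eq_right hkn.le]
    have := initInj_uBar_limitToColimit p (Nat.succ_le_of_lt hkn)
    exact congrArg (uBar F) (ConcreteCategory.congr_hom this (iterPoint F p k (x.1 k)))
  · rw [min_eq_left hnk, epsilon_eq_epsilon_iff, epsilon_apply_val p hnk]

/-- The order on `F^ω 1`: `t ≤ s` iff `t = s` or `t = ε_n(s)` for some `n`. -/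
noncomputable abbrev epsilonOrder : PartialOrder (OmegaLimit F) :=
  truncationOrder (fun n x => epsilon F p n x) (epsilon_epsilon p)

theorem isTruncationSystem_epsilon :
    letI := epsilonOrder p
    IsTruncationSystem fun n x => epsilon F p n x :=
  letI := epsilonOrder p
  { le_iff := fun _ _ => Iff.rfl
    comp := epsilon_epsilon p
    ext := fun t s hts => Subtype.ext (funext fun n => (epsilon_eq_epsilon_iff p).1 (hts n))
    exists_of_coherent := fun x hx => by
      have hcoh : ∀ n, (x (n + 1)).1 n = (x n).1 n := fun n => (epsilon_eq_epsilon_iff p).1 (hx n)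
      exact ⟨⟨fun n => (x n).1 n, fun n => ((x (n + 1)).2 n).trans (hcoh n)⟩,
        fun n => (epsilon_eq_epsilon_iff p).2 rfl⟩ }

end Truncation

section Finitary

variable (F : Type u ⥤ Type u)

theorem map_injective_of_nonempty {X Y : Type u} [Nonempty X] (f : X ⟶ Y)
    (hf : Function.Injective f) : Function.Injective (F.map f) := by
  have : IsSplitMono f := IsSplitMono.mk' ⟨↾(Function.invFun f), by
    ext x
    exact Function.leftInverse_invFun hf x⟩
  exact (mono_iff_injective (F.map f)).1 inferInstance

theorem range_map_subtypeVal_mono {X : Type u} {S T : Set X} (hST : S ⊆ T) :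
    Set.range (F.map (↾(Subtype.val : S → X))) ⊆ Set.range (F.map (↾(Subtype.val : T → X))) := by
  rintro _ ⟨b, rfl⟩
  exact ⟨F.map (↾(Set.inclusion hST)) b,
    ConcreteCategory.congr_hom
      (F.map_comp (↾(Set.inclusion hST)) (↾(Subtype.val : T → X))).symm b⟩

theorem exists_finite_mem_range_map [PreservesFilteredColimits F] {X : Type u} (a : F.obj X) :
    ∃ S : Set X, S.Finite ∧ a ∈ Set.range (F.map (↾(Subtype.val : S → X))) := by
  have := HasCardinalLT.Set.isFiltered_of_aleph0_le X Cardinal.aleph0 le_rfl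
  obtain ⟨S, b, hb⟩ := Types.jointly_surjective _ (isColimitOfPreserves F
    (HasCardinalLT.Set.isColimitCocone X Cardinal.aleph0 le_rfl)) a
  exact ⟨S.1, (hasCardinalLT_aleph0_iff _).1 S.2, b, hb⟩

theorem exists_finite_mem_range_map₂ [PreservesFilteredColimits F] {X : Type u}
    (a b : F.obj X) (x : X) : ∃ S : Set X, S.Finite ∧ x ∈ S ∧
      a ∈ Set.range (F.map (↾(Subtype.val : S → X))) ∧
      b ∈ Set.range (F.map (↾(Subtype.val : S → X))) := by
  obtain ⟨S, hS, ha⟩ := exists_finite_mem_range_map F a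
  obtain ⟨T, hT, hb⟩ := exists_finite_mem_range_map F b
  refine ⟨insert x (S ∪ T), (hS.union hT).insert x, Set.mem_insert _ _, ?_, ?_⟩
  · exact range_map_subtypeVal_mono F
      (Set.subset_union_left.trans (Set.subset_insert _ _)) ha
  · exact range_map_subtypeVal_mono F
      (Set.subset_union_right.trans (Set.subset_insert _ _)) hb

end Finitary

section LimitAlgebra

variable (F : Type u ⥤ Type u)

/-- The components `F(F^ω 1) ⟶ Fⁿ1` of the connecting map `v_{ω+1,ω}`. -/
def limitStrStage : ∀ n, F.obj (OmegaLimit F) ⟶ termChain F n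
  | 0 => ↾(fun _ => PUnit.unit)
  | n + 1 => F.map (termProj F n)

theorem termProj_termChainMap (n : ℕ) :
    termProj F (n + 1) ≫ termChainMap F n = termProj F n := by
  ext x
  exact x.2 n

theorem limitStrStage_termChainMap (n : ℕ) :
    limitStrStage F (n + 1) ≫ termChainMap F n = limitStrStage F n := by
  cases n with
  | zero => rfl
  | succ n =>
    change F.map (termProj F (n + 1)) ≫ F.map (termChainMap F n) = F.map (termProj F n)
    rw [← F.map_comp, termProj_termChainMap]

/-- The connecting map `v_{ω+1,ω} : F(F^ω 1) ⟶ F^ω 1`. -/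
def limitStr : F.obj (OmegaLimit F) ⟶ OmegaLimit F :=
  ↾(fun a => ⟨fun n => limitStrStage F n a,
    fun n => ConcreteCategory.congr_hom (limitStrStage_termChainMap F n) a⟩)

theorem limitStr_termProj_succ (n : ℕ) :
    limitStr F ≫ termProj F (n + 1) = F.map (termProj F n) := rfl

variable {F}

theorem eventually_val_ne {x y : OmegaLimit F} (hxy : x ≠ y) :
    ∀ᶠ n in Filter.atTop, x.1 n ≠ y.1 n := by
  obtain ⟨k, hk⟩ := Function.ne_iff.1 (Subtype.coe_ne_coe.2 hxy)
  filter_upwards [Filter.eventually_ge_atTop k] with n hkn hn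
  exact hk (OmegaLimit.val_eq_val_of_le hkn hn)

theorem exists_injOn_termProj {S : Set (OmegaLimit F)} (hS : S.Finite) :
    ∃ n, Set.InjOn (termProj F n) S := by
  have hsep : ∀ᶠ n in Filter.atTop, ∀ x ∈ S, ∀ y ∈ S, x ≠ y → x.1 n ≠ y.1 n := by
    simp only [Filter.eventually_all_finite hS, Filter.eventually_imp_distrib_left]
    exact fun x _ y _ => eventually_val_ne
  obtain ⟨n, hn⟩ := hsep.exists
  exact ⟨n, fun x hx y hy hxy => not_imp_not.1 (hn x hx y hy) hxy⟩

/-- Two elements of `F(F^ω 1)` come from `F S` for a finite nonempty `S ⊆ F^ω 1`, which is mapped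
injectively to some stage `Fⁿ1`, and `F` preserves the injectivity. -/
theorem limitStr_injective [PreservesFilteredColimits F] :
    Function.Injective (limitStr F) := fun a b hab => by
  obtain ⟨S, hS, hxS, ⟨a, rfl⟩, ⟨b, rfl⟩⟩ := exists_finite_mem_range_map₂ F a b (limitStr F a)
  obtain ⟨n, hn⟩ := exists_injOn_termProj hS
  have : Nonempty S := ⟨⟨_, hxS⟩⟩
  have hinj := map_injective_of_nonempty F
    (↾(Subtype.val : S → OmegaLimit F) ≫ termProj F n) hn.injective
  refine congrArg _ (hinj ?_)
  rw [F.map_comp, ← limitStr_termProj_succ]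
  exact congrArg (termProj F (n + 1)) hab

theorem coalgToLimit_eq (X : Endofunctor.Coalgebra F) :
    coalgToLimit X = X.str ≫ F.map (coalgToLimit X) ≫ limitStr F :=
  OmegaLimit.hom_ext fun n => by
    cases n with
    | zero => rfl
    | succ n =>
      change X.str ≫ F.map (coalgToLimit X ≫ termProj F n) =
        X.str ≫ F.map (coalgToLimit X) ≫ F.map (termProj F n)
      rw [F.map_comp]

theorem hom_coalgToStage {X Y : Endofunctor.Coalgebra F} (f : X ⟶ Y) (n : ℕ) :
    f.f ≫ coalgToStage Y n = coalgToStage X n := by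
  induction n with
  | zero => rfl
  | succ n ih =>
    change f.f ≫ Y.str ≫ F.map (coalgToStage Y n) = X.str ≫ F.map (coalgToStage X n)
    rw [← ih, F.map_comp, ← Category.assoc, ← Category.assoc, f.h]

theorem hom_coalgToLimit {X Y : Endofunctor.Coalgebra F} (f : X ⟶ Y) :
    f.f ≫ coalgToLimit Y = coalgToLimit X :=
  OmegaLimit.hom_ext fun n => hom_coalgToStage f n

end LimitAlgebra

section TerminalCoalgebra

variable (F : Type u ⥤ Type u)

/-- The elements of `F^ω 1` which are the image of an element of some coalgebra. They carry the
terminal coalgebra. -/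
def Behaviour : Type u :=
  {t : OmegaLimit F // ∃ (X : Endofunctor.Coalgebra F) (x : X.V), coalgToLimit X x = t}

/-- The inclusion of the behaviours into `F^ω 1`. -/
def behaviourIncl : Behaviour F ⟶ OmegaLimit F := ↾(fun t => t.1)

theorem behaviourIncl_injective : Function.Injective (behaviourIncl F) :=
  Subtype.val_injective

variable {F}

/-- The corestriction of `coalgToLimit X` to the behaviours. -/
def toBehaviour (X : Endofunctor.Coalgebra F) : X.V ⟶ Behaviour F :=
  ↾(fun x => ⟨coalgToLimit X x, X, x, rfl⟩)

theorem toBehaviour_incl (X : Endofunctor.Coalgebra F) :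
    toBehaviour X ≫ behaviourIncl F = coalgToLimit X := rfl

theorem str_map_toBehaviour (X : Endofunctor.Coalgebra F) :
    (X.str ≫ F.map (toBehaviour X)) ≫ F.map (behaviourIncl F) ≫ limitStr F = coalgToLimit X := by
  rw [Category.assoc, ← Category.assoc (F.map _), ← F.map_comp, toBehaviour_incl,
    ← coalgToLimit_eq]

variable [PreservesFilteredColimits F]

theorem toBehaviour_str_congr {X Y : Endofunctor.Coalgebra F} {x : X.V} {y : Y.V}
    (hxy : coalgToLimit X x = coalgToLimit Y y) :
    F.map (toBehaviour X) (X.str x) = F.map (toBehaviour Y) (Y.str y) := by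
  have : Nonempty (Behaviour F) := ⟨toBehaviour X x⟩
  apply map_injective_of_nonempty F _ (behaviourIncl_injective F)
  apply limitStr_injective
  rw [← str_map_toBehaviour X, ← str_map_toBehaviour Y] at hxy
  exact hxy

variable (F) in
/-- The coalgebra of behaviours. The structure map is computed in any coalgebra containing an
element with the given behaviour; by `toBehaviour_str_congr` the choice does not matter. -/
noncomputable def behaviourCoalgebra : Endofunctor.Coalgebra F where
  V := Behaviour F
  str := ↾(fun t => F.map (toBehaviour t.2.choose) (t.2.choose.str t.2.choose_spec.choose))

/-- The behaviour map of a coalgebra, as a homomorphism. -/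
noncomputable def toBehaviourHom (X : Endofunctor.Coalgebra F) : X ⟶ behaviourCoalgebra F where
  f := toBehaviour X
  h := by
    ext x
    exact toBehaviour_str_congr (toBehaviour X x).2.choose_spec.choose_spec.symm

variable (F) in
theorem coalgToLimit_behaviourCoalgebra :
    coalgToLimit (behaviourCoalgebra F) = behaviourIncl F := by
  ext ⟨_, X, x, rfl⟩
  exact ConcreteCategory.congr_hom (hom_coalgToLimit (toBehaviourHom X)) x

variable (F) in
/-- Terminality of the coalgebra of behaviours: the behaviour maps are the unique homomorphisms. -/
noncomputable def isTerminalBehaviourCoalgebra : IsTerminal (behaviourCoalgebra F) :=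
  IsTerminal.ofUniqueHom toBehaviourHom fun X g => by
    ext x
    apply behaviourIncl_injective F
    have hg := hom_coalgToLimit g
    rw [coalgToLimit_behaviourCoalgebra] at hg
    exact ConcreteCategory.congr_hom hg x

theorem coalgToLimit_injective {N : Endofunctor.Coalgebra F} (hN : IsTerminal N) :
    Function.Injective (coalgToLimit N) := by
  have := isIso_of_isTerminal hN (isTerminalBehaviourCoalgebra F) (toBehaviourHom N)
  have hbij : Function.Bijective (toBehaviourHom N).f :=
    (isIso_iff_bijective _).1
      (inferInstanceAs (IsIso ((Endofunctor.Coalgebra.forget F).map (toBehaviourHom N))))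
  exact (behaviourIncl_injective F).comp hbij.injective

end TerminalCoalgebra

section InitialAlgebra

variable {F : Type u ⥤ Type u}

/-- The canonical maps `Fⁿ0 ⟶ B` to the carrier of an algebra `B`. -/
def stageToAlg (B : Endofunctor.Algebra F) : ∀ n : ℕ, initChain F n ⟶ B.a
  | 0 => ↾(fun x : PEmpty.{u + 1} => x.elim)
  | n + 1 => F.map (stageToAlg B n) ≫ B.str

theorem initChainMap_stageToAlg (B : Endofunctor.Algebra F) (n : ℕ) :
    initChainMap F n ≫ stageToAlg B (n + 1) = stageToAlg B n := by
  induction n with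
  | zero => ext x; exact x.elim
  | succ n ih =>
    change F.map (initChainMap F n) ≫ F.map (stageToAlg B (n + 1)) ≫ B.str =
      F.map (stageToAlg B n) ≫ B.str
    rw [← Category.assoc, ← F.map_comp, ih]

theorem stageToAlg_hom {B B' : Endofunctor.Algebra F} (f : B ⟶ B') (n : ℕ) :
    stageToAlg B n ≫ f.f = stageToAlg B' n := by
  induction n with
  | zero => ext x; exact x.elim
  | succ n ih =>
    change (F.map (stageToAlg B n) ≫ B.str) ≫ f.f = F.map (stageToAlg B' n) ≫ B'.str
    rw [← ih, F.map_comp, Category.assoc, Category.assoc, f.h]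

/-- The map `F^ω 0 ⟶ B` to the carrier of an algebra `B` induced by the maps from the stages. -/
noncomputable def colimitToAlg (B : Endofunctor.Algebra F) : OmegaColimit F ⟶ B.a :=
  colimit.desc (Functor.ofSequence (initChainMap F))
    { pt := B.a
      ι := NatTrans.ofSequence (F := Functor.ofSequence (initChainMap F))
        (G := (Functor.const ℕ).obj B.a) (stageToAlg B) (fun n => by
          rw [Functor.ofSequence_map_homOfLE_succ]
          exact (initChainMap_stageToAlg B n).trans (Category.comp_id _).symm) }

theorem initInj_colimitToAlg (B : Endofunctor.Algebra F) (n : ℕ) :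
    initInj F n ≫ colimitToAlg B = stageToAlg B n :=
  colimit.ι_desc _ _

variable (F)

instance preservesColimit_initChain [PreservesFilteredColimits F] :
    PreservesColimit (Functor.ofSequence (initChainMap F)) F :=
  have : PreservesFilteredColimitsOfSize.{0, 0} F :=
    preservesFilteredColimitsOfSize_shrink.{0, u, 0, u} F
  have := PreservesFilteredColimitsOfSize.preserves_filtered_colimits (F := F) ℕ
  inferInstance

variable [PreservesColimit (Functor.ofSequence (initChainMap F)) F]

/-- The image of the colimit cocone of `F^ω 0` under `F`, as a colimit cocone. -/
noncomputable def isColimitMapOmegaColimit :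
    IsColimit (F.mapCocone (colimit.cocone (Functor.ofSequence (initChainMap F)))) :=
  isColimitOfPreserves F (colimit.isColimit _)

/-- The structure map `F(F^ω 0) ⟶ F^ω 0`, induced by the injections `Fⁿ⁺¹0 ⟶ F^ω 0`. -/
noncomputable def omegaStr : F.obj (OmegaColimit F) ⟶ OmegaColimit F :=
  (isColimitMapOmegaColimit F).desc
    { pt := OmegaColimit F
      ι := NatTrans.ofSequence (F := Functor.ofSequence (initChainMap F) ⋙ F)
        (G := (Functor.const ℕ).obj (OmegaColimit F)) (fun n => initInj F (n + 1)) (fun n => by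
          rw [Functor.comp_map, Functor.ofSequence_map_homOfLE_succ]
          exact (initChainMap_initInj F (n + 1)).trans (Category.comp_id _).symm) }

theorem map_initInj_omegaStr (n : ℕ) : F.map (initInj F n) ≫ omegaStr F = initInj F (n + 1) :=
  (isColimitMapOmegaColimit F).fac _ n

/-- The algebra `F^ω 0`. -/
noncomputable def omegaAlgebra : Endofunctor.Algebra F := ⟨OmegaColimit F, omegaStr F⟩

theorem stageToAlg_omegaAlgebra (n : ℕ) : stageToAlg (omegaAlgebra F) n = initInj F n := by
  induction n with
  | zero => ext x; exact x.elim
  | succ n ih =>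
    change F.map (stageToAlg (omegaAlgebra F) n) ≫ omegaStr F = _
    rw [ih]
    exact map_initInj_omegaStr F n

variable {F}

theorem map_omegaColimit_hom_ext {X : Type u} {f g : F.obj (OmegaColimit F) ⟶ X}
    (h : ∀ n, F.map (initInj F n) ≫ f = F.map (initInj F n) ≫ g) : f = g :=
  (isColimitMapOmegaColimit F).hom_ext h

/-- The map `F^ω 0 ⟶ B`, as a homomorphism. -/
noncomputable def omegaDesc (B : Endofunctor.Algebra F) : omegaAlgebra F ⟶ B where
  f := colimitToAlg B
  h := map_omegaColimit_hom_ext fun n => by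
    change F.map (initInj F n) ≫ F.map (colimitToAlg B) ≫ B.str =
      F.map (initInj F n) ≫ omegaStr F ≫ colimitToAlg B
    rw [← Category.assoc, ← F.map_comp, ← Category.assoc, map_initInj_omegaStr,
      initInj_colimitToAlg]
    exact (initInj_colimitToAlg B (n + 1)).symm

variable (F) in
/-- Initiality of `F^ω 0`: the maps induced from the stages are the unique homomorphisms. -/
noncomputable def isInitialOmegaAlgebra : IsInitial (omegaAlgebra F) :=
  IsInitial.ofUniqueHom omegaDesc fun B g => by
    refine Endofunctor.Algebra.ext (OmegaColimit.hom_ext fun n => ?_)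
    have hg := stageToAlg_hom g n
    rw [stageToAlg_omegaAlgebra] at hg
    exact hg.trans (initInj_colimitToAlg B n).symm

theorem colimitToAlg_bijective {M : Endofunctor.Algebra F} (hM : IsInitial M) :
    Function.Bijective (colimitToAlg M) := by
  have := isIso_of_isInitial (isInitialOmegaAlgebra F) hM (omegaDesc M)
  exact (isIso_iff_bijective _).1
    (inferInstanceAs (IsIso ((Endofunctor.Algebra.forget F).map (omegaDesc M))))

end InitialAlgebra

section Comparison

variable {F : Type u ⥤ Type u}

theorem stageToAlg_comp_coalgToStage {B : Endofunctor.Algebra F} {X : Endofunctor.Coalgebra F}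
    {f : B.a ⟶ X.V} (hf : B.str ≫ f ≫ X.str = F.map f) (m n : ℕ) :
    stageToAlg B m ≫ f ≫ coalgToStage X n = cross F m n := by
  induction m generalizing n with
  | zero => ext x; exact x.elim
  | succ m ih =>
    cases n with
    | zero => rfl
    | succ n =>
      change (F.map (stageToAlg B m) ≫ B.str) ≫ f ≫ X.str ≫ F.map (coalgToStage X n) =
        F.map (cross F m n)
      rw [← ih, F.map_comp, F.map_comp, ← hf]
      simp only [Category.assoc]

theorem colimitToAlg_comp_coalgToLimit {B : Endofunctor.Algebra F} {X : Endofunctor.Coalgebra F}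
    {f : B.a ⟶ X.V} (hf : B.str ≫ f ≫ X.str = F.map f) :
    colimitToAlg B ≫ f ≫ coalgToLimit X = uBar F :=
  OmegaColimit.hom_ext fun m => OmegaLimit.hom_ext fun n => calc
    _ = (initInj F m ≫ colimitToAlg B) ≫ f ≫ coalgToStage X n := rfl
    _ = cross F m n := by rw [initInj_colimitToAlg, stageToAlg_comp_coalgToStage hf]
    _ = (initInj F m ≫ uBar F) ≫ termProj F n := by rw [initInj_uBar]; rfl

variable {M : Endofunctor.Algebra F} (hM : IsInitial M) {N : Endofunctor.Coalgebra F}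
  (hN : IsTerminal N)

theorem muToNu_str : muToNu hM hN ≫ N.str = iotaInv hM ≫ F.map (muToNu hM hN) :=
  (hN.from ⟨M.a, iotaInv hM⟩).h.symm

theorem str_muToNu_str : M.str ≫ muToNu hM hN ≫ N.str = F.map (muToNu hM hN) := by
  rw [muToNu_str, ← Category.assoc, Endofunctor.Algebra.Initial.right_inv, Category.id_comp]

theorem colimitToAlg_muToNu_coalgToLimit :
    colimitToAlg M ≫ muToNu hM hN ≫ coalgToLimit N = uBar F :=
  colimitToAlg_comp_coalgToLimit (str_muToNu_str hM hN)

theorem muToNu_injective [PreservesColimit (Functor.ofSequence (initChainMap F)) F]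
    (p : F.obj PEmpty.{u + 1}) : Function.Injective (muToNu hM hN) := by
  have hinj := uBar_injective p
  rw [← colimitToAlg_muToNu_coalgToLimit hM hN] at hinj
  have hcomp : Function.Injective (coalgToLimit N ∘ muToNu hM hN) :=
    hinj.of_comp_right (g := colimitToAlg M) (colimitToAlg_bijective hM).surjective
  exact hcomp.of_comp

theorem epsilon_mem_image_range_muToNu (p : F.obj PEmpty.{u + 1}) (n : ℕ) (s : OmegaLimit F) :
    epsilon F p n s ∈ coalgToLimit N '' Set.range (muToNu hM hN) := by
  obtain ⟨x, hx⟩ := epsilon_mem_range_uBar p n s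
  rw [← colimitToAlg_muToNu_coalgToLimit hM hN] at hx
  exact ⟨_, ⟨colimitToAlg M x, rfl⟩, hx⟩

/-- The structure map `ι` of an initial algebra, as a bijection. -/
noncomputable def initialStrEquiv : F.obj M.a ≃ M.a :=
  Iso.toEquiv ⟨M.str, iotaInv hM, Endofunctor.Algebra.Initial.right_inv hM,
    Endofunctor.Algebra.Initial.left_inv hM⟩

/-- The structure map `τ` of a terminal coalgebra, as a bijection. -/
noncomputable def terminalStrEquiv : N.V ≃ F.obj N.V :=
  Iso.toEquiv ⟨N.str, Endofunctor.Coalgebra.Terminal.strInv hN,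
    Endofunctor.Coalgebra.Terminal.right_inv hN, Endofunctor.Coalgebra.Terminal.left_inv hN⟩

end Comparison

end SetFunctor

theorem theoremT4p12 (F : Type u ⥤ Type u) [PreservesFilteredColimits F]
    (p : F.obj PEmpty.{u + 1}) :
    HasInitial (Endofunctor.Algebra F) ∧ HasTerminal (Endofunctor.Coalgebra F) ∧
    ∀ (M : Endofunctor.Algebra F) (hM : IsInitial M)
      (N : Endofunctor.Coalgebra F) (hN : IsTerminal N),
      ∃ (_ : PartialOrder (SetFunctor.OmegaLimit F)) (_ : PartialOrder N.V)
        (_ : PartialOrder M.a) (_ : PartialOrder (F.obj N.V)) (_ : PartialOrder (F.obj M.a)),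
        -- the order of `F^ω 1`
        (∀ t s : SetFunctor.OmegaLimit F, t ≤ s ↔ t = s ∨ ∃ n, t = SetFunctor.epsilon F p n s) ∧
        -- `νF` is a subposet of `F^ω 1`, and `μF` is a subposet of `νF`
        (∀ t s : N.V, t ≤ s ↔ SetFunctor.coalgToLimit N t ≤ SetFunctor.coalgToLimit N s) ∧
        (∀ t s : M.a, t ≤ s ↔ SetFunctor.muToNu hM hN t ≤ SetFunctor.muToNu hM hN s) ∧
        -- the isomorphisms `τ` and `ι` transport the orders to `F(νF)` and `F(μF)`
        (∀ t s : N.V, N.str t ≤ N.str s ↔ t ≤ s) ∧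
        (∀ t s : F.obj M.a, M.str t ≤ M.str s ↔ t ≤ s) ∧
        -- `F^ω 1` is a conservative completion of both `μF` and `νF`
        SetFunctor.IsConservativeCompletion
          (fun t : M.a => SetFunctor.coalgToLimit N (SetFunctor.muToNu hM hN t)) ∧
        SetFunctor.IsConservativeCompletion (fun t : N.V => SetFunctor.coalgToLimit N t) ∧
        -- `F(μF)` is a subposet of `F(νF)`, and `ι⁻¹` is continuous
        (∀ t s : F.obj M.a,
          F.map (SetFunctor.muToNu hM hN) t ≤ F.map (SetFunctor.muToNu hM hN) s ↔ t ≤ s) ∧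
        ScottContinuous (fun t : M.a => SetFunctor.iotaInv hM t) ∧
        -- `τ` is the unique continuous extension of `ι⁻¹`
        ScottContinuous (fun t : N.V => N.str t) ∧
        (∀ t : M.a, N.str (SetFunctor.muToNu hM hN t) =
          F.map (SetFunctor.muToNu hM hN) (SetFunctor.iotaInv hM t)) ∧
        ∀ g : N.V → F.obj N.V, ScottContinuous g →
          (∀ t : M.a, g (SetFunctor.muToNu hM hN t) =
            F.map (SetFunctor.muToNu hM hN) (SetFunctor.iotaInv hM t)) →
          ∀ t : N.V, g t = N.str t := by
  refine ⟨(SetFunctor.isInitialOmegaAlgebra F).hasInitial,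
    (SetFunctor.isTerminalBehaviourCoalgebra F).hasTerminal, fun M hM N hN => ?_⟩
  let oL := SetFunctor.epsilonOrder p
  let oN : PartialOrder N.V := .lift _ (SetFunctor.coalgToLimit_injective hN)
  let oM : PartialOrder M.a := .lift _ (SetFunctor.muToNu_injective hM hN p)
  let oFN := PartialOrder.lift _ (SetFunctor.terminalStrEquiv hN).symm.injective
  let oFM := PartialOrder.lift _ (SetFunctor.initialStrEquiv hM).injective
  let h := OrderEmbedding.ofMapLEIff (SetFunctor.coalgToLimit N) fun _ _ => Iff.rfl
  let m := OrderEmbedding.ofMapLEIff (SetFunctor.muToNu hM hN) fun _ _ => Iff.rfl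
  let τ : N.V ≃o F.obj N.V := (SetFunctor.liftOrderIso (SetFunctor.terminalStrEquiv hN).symm).symm
  let ι : F.obj M.a ≃o M.a := SetFunctor.liftOrderIso (SetFunctor.initialStrEquiv hM)
  have hε := SetFunctor.isTruncationSystem_epsilon p
  have hεm := SetFunctor.epsilon_mem_image_range_muToNu hM hN p
  have hτ := SetFunctor.scottContinuous_orderIso τ
  have hτm := ConcreteCategory.congr_hom (SetFunctor.muToNu_str hM hN)
  have hFm : ∀ t, F.map (SetFunctor.muToNu hM hN) t = τ (m (ι t)) := fun t =>
    (ConcreteCategory.congr_hom (SetFunctor.str_muToNu_str hM hN) t).symm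
  refine ⟨oL, oN, oM, oFN, oFM, fun _ _ => Iff.rfl, fun _ _ => Iff.rfl, fun _ _ => Iff.rfl,
    fun _ _ => τ.le_iff_le, fun _ _ => Iff.rfl,
    hε.isConservativeCompletion (m.trans h) fun n s => Set.range_comp h m ▸ hεm n s,
    hε.isConservativeCompletion h fun n s => Set.image_subset_range _ _ (hεm n s),
    fun t s => by rw [hFm, hFm, τ.le_iff_le, m.le_iff_le, ι.le_iff_le],
    SetFunctor.scottContinuous_orderIso ι.symm, hτ, hτm, fun g hg hgm => congrFun ?_⟩
  refine (hε.directedDense h hεm).eq_of_eqOn hg hτ (Set.forall_mem_range.2 fun x => ?_)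
  exact (hgm x).trans (hτm x).symm
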